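/- Let $A\in\mathbb R^{n\times n}$ be a system matrix, let $C_i\in\mathbb R^{p_i\times n}$ be the output matrix of agent $i\in\{1,\dots,N\}$, and let $W=(w_{ij})\in\mathbb R^{N\times N}$ be a state-fusion matrix with $w_{ii}\neq 0$ for all $i$. The zero patterns of $A$, $W$ and $C_1,\dots,C_N$ are fixed, and all their nonzero entries are regarded as independent free real parameters (in particular, no row-sum normalization is imposed on $W$). A property is *generic* if all parameter values for which it fails lie on a proper algebraic variety (the zero set of a nonzero polynomial in the parameters), which has Lebesgue measure zero. In the state digraph of $A=(a_{ij})$ there is an edge $a\to b$ iff $a_{ba}\neq0$; in the communication network $G_W$ there is an edge $j\to i$ iff $w_{ij}\neq0$ (agent $i$ receives from agent $j$). A *parent SCC* of $A$ is a strongly connected component of the state digraph with no edge leaving it. Agent $i$ *observes* state $a$ if column $a$ of $C_i$ is nonzero. The matrix $A$ has *full structural rank* if the maximum of the rank over all numerical values of its nonzero entries is $n$. A pair $(F,H)$ with $F\in\mathbb R^{d\times d}$ is *observable* if the matrix $[H^T,\;F^TH^T,\;\dots,\;(F^{d-1})^TH^T]$ has rank $d$. **Theorem.** Suppose that $A$ has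 full structural rank and that for every parent SCC $\mathcal K$ of $A$, every agent that observes no state of $\mathcal K$ has a directed path in $G_W$ to some agent that observes a state of $\mathcal K$. Then the pair $(W\otimes A,\overline{D_C})$, where $\overline{D_C}=\operatorname{blockdiag}(C_1^TC_1,\dots,C_N^TC_N)$ (no output fusion), is generically observable: it is observable for all values of the nonzero entries of $W,A,C_1,\dots,C_N$ outside a proper algebraic variety of Lebesgue measure zero. -/

import Mathlib

open scoped Kronecker
open MeasureTheory

namespace NetEst

/-! ### Structured matrices: the nonzero entries are free real parameters, the zeros are fixed -/

/-- The positions of the nonzero entries of a matrix, i.e. its free parameters. -/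
abbrev FreeEntry {m n : Type} (M : Matrix m n ℝ) : Type :=
  {e : m × n // M e.1 e.2 ≠ 0}

open Classical in
/-- The matrix with the zero pattern of `M` in which the nonzero entries of `M` are replaced by the
values `θ`. -/
noncomputable def fill {m n : Type} (M : Matrix m n ℝ) (θ : FreeEntry M → ℝ) : Matrix m n ℝ :=
  Matrix.of fun i j => if h : M i j ≠ 0 then θ ⟨(i, j), h⟩ else 0

/-- Structural (generic) rank: the maximum rank over all numerical values of the nonzero entries.
(The set of ranks is nonempty and bounded by the number of columns, so `sSup` is its maximum.) -/
noncomputable def sRank {m n : Type} [Fintype n] (M : Matrix m n ℝ) : ℕ :=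
  sSup (Set.range fun θ : FreeEntry M → ℝ => (fill M θ).rank)

/-- A property of finitely many real parameters is generic if the parameter values for which it
fails all lie on a (proper) algebraic variety, of Lebesgue measure zero. -/
def IsGeneric {ι : Type} [Fintype ι] (P : (ι → ℝ) → Prop) : Prop :=
  ∃ p : MvPolynomial ι ℝ, p ≠ 0 ∧
    volume {θ : ι → ℝ | MvPolynomial.eval θ p = 0} = 0 ∧
    ∀ θ : ι → ℝ, ¬ P θ → MvPolynomial.eval θ p = 0

/-! ### Observability -/

/-- The observability matrix `[Hᵀ, FᵀHᵀ, …, (F^(d-1))ᵀHᵀ]`, with `d` the number of states. -/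
noncomputable def obsMatrix {σ κ : Type} [Fintype σ] [DecidableEq σ]
    (F : Matrix σ σ ℝ) (H : Matrix κ σ ℝ) : Matrix σ (Fin (Fintype.card σ) × κ) ℝ :=
  Matrix.of fun s tk => ((F ^ (tk.1 : ℕ)).transpose * H.transpose) s tk.2

/-- The pair `(F, H)` is observable: the observability matrix has full rank. -/
def Observable {σ κ : Type} [Fintype σ] [DecidableEq σ] [Fintype κ]
    (F : Matrix σ σ ℝ) (H : Matrix κ σ ℝ) : Prop :=
  (obsMatrix F H).rank = Fintype.card σ

/-- The block diagonal matrix with blocks `C₁ᵀC₁, …, C_NᵀC_N` (no output fusion); coordinates are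
pairs (agent, state). -/
noncomputable def outputNoFusion {n N : ℕ} {p : Fin N → ℕ}
    (C : ∀ i : Fin N, Matrix (Fin (p i)) (Fin n) ℝ) :
    Matrix (Fin N × Fin n) (Fin N × Fin n) ℝ :=
  Matrix.of fun x y => if x.1 = y.1 then ((C x.1).transpose * C x.1) x.2 y.2 else 0

/-- The free parameters of the networked system: the nonzero entries of `W`, of `A` and of all the
output matrices `C i`. -/
abbrev NetParam {n N : ℕ} {p : Fin N → ℕ} (W : Matrix (Fin N) (Fin N) ℝ)
    (A : Matrix (Fin n) (Fin n) ℝ) (C : ∀ i : Fin N, Matrix (Fin (p i)) (Fin n) ℝ) : Type :=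
  FreeEntry W ⊕ FreeEntry A ⊕ (Σ i : Fin N, FreeEntry (C i))

/-- Generic observability of `(W ⊗ A, blockdiag (CᵢᵀCᵢ))`: the pair is observable for almost all
values of the nonzero entries of `W`, `A`, `C₁, …, C_N`. -/
def GenericallyObservableNoFusion {n N : ℕ} {p : Fin N → ℕ} (W : Matrix (Fin N) (Fin N) ℝ)
    (A : Matrix (Fin n) (Fin n) ℝ) (C : ∀ i : Fin N, Matrix (Fin (p i)) (Fin n) ℝ) : Prop :=
  IsGeneric fun θ : NetParam W A C → ℝ =>
    Observable
      (fill W (fun e => θ (Sum.inl e)) ⊗ₖ fill A (fun e => θ (Sum.inr (Sum.inl e))))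
      (outputNoFusion fun i => fill (C i) (fun e => θ (Sum.inr (Sum.inr ⟨i, e⟩))))

/-! ### Digraphs -/

/-- The digraph of a square matrix: there is an edge `a → b` iff the entry in row `b`, column `a`
is nonzero. This is used for the state digraph of `A` and for the communication network of `W`. -/
def Edge {V : Type} (M : Matrix V V ℝ) (a b : V) : Prop := M b a ≠ 0

/-- There is a directed path (possibly of length zero) from `a` to `b`. -/
def HasPath {V : Type} (M : Matrix V V ℝ) (a b : V) : Prop := Relation.ReflTransGen (Edge M) a b

/-- `K` is a strongly connected component of the digraph of `M`. -/
def IsSCC {V : Type} (M : Matrix V V ℝ) (K : Set V) : Prop :=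
  ∃ a : V, K = {b | HasPath M a b ∧ HasPath M b a}

/-- A parent SCC: an SCC without outgoing edges to vertices outside it. -/
def IsParentSCC {V : Type} (M : Matrix V V ℝ) (K : Set V) : Prop :=
  IsSCC M K ∧ ∀ a ∈ K, ∀ b, Edge M a b → b ∈ K

/-- An agent with output matrix `Ci` observes some state of `K`. -/
def Observes {q n : ℕ} (Ci : Matrix (Fin q) (Fin n) ℝ) (K : Set (Fin n)) : Prop :=
  ∃ a ∈ K, ∃ k : Fin q, Ci k a ≠ 0

end NetEst

/-! The entries of the observability matrix are polynomials in the parameters, so observability is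
generic as soon as it holds at one point, and finitely many generic properties hold simultaneously.
Three are combined. (1) `W ⊗ A` is observable from one scalar output. Its eigenspaces are then
lines, and since `W ⊗ 1` and `1 ⊗ A` commute with it, every eigenvector is a pure tensor `u ⊗ v`.
(2) For each parent SCC `K`, the network `W` is observable from the agents that observe `K`. (3) For
each choice of one observing agent per parent SCC, `A` is observable from the chosen outputs
together.

If `u ⊗ v` is an unobservable eigenvector, then `u j • C j v = 0` for every agent `j`. By (3) some
`K` has `C j v ≠ 0` for all its observers `j`; otherwise choosing a bad observer for every `K` would
give `v = 0`. So `u` vanishes on the observers of `K`, and (2) gives `u = 0`.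

The points witnessing (2) and (3) come from `exists_root_of_cycle_forest`. A permutation supported
on the pattern receives distinct positive weights on its cycles, and one link leads from each
non-root cycle to a cycle nearer a root. The modulus of an eigenvalue singles out the cycle where
the support begins; the support then follows the links to exactly one root cycle, where it is seen.
For (1) every cycle is a root. -/

namespace NetEst

/-! ### Null sets of polynomials and generic properties -/

/-- The zero set of a nonzero real polynomial in finitely many ordered variables is a null set. -/
theorem volume_zeroSet_fin : ∀ (n : ℕ) (p : MvPolynomial (Fin n) ℝ), p ≠ 0 →
    volume {x : Fin n → ℝ | MvPolynomial.eval x p = 0} = 0 := by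
  intro n
  induction n with
  | zero =>
    intro p hp
    have : {x : Fin 0 → ℝ | MvPolynomial.eval x p = 0} = ∅ := by
      rw [Set.eq_empty_iff_forall_notMem]
      intro x hx
      apply hp
      apply MvPolynomial.funext
      intro y
      rw [Subsingleton.elim y x, map_zero]
      exact hx
    simp [this]
  | succ n ih =>
    intro p hp
    have hf : MvPolynomial.finSuccEquiv ℝ n p ≠ 0 := by simpa using hp
    set f := MvPolynomial.finSuccEquiv ℝ n p with hfdef
    -- Fubini: off the null set where the leading coefficient in the first variable vanishes, each
    -- slice of the zero set is finite.
    have hlead := ih f.leadingCoeff (by simpa using hf)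
    set S : Set ((Fin n → ℝ) × ℝ) := {z | MvPolynomial.eval (Fin.cons z.2 z.1 : Fin (n + 1) → ℝ) p = 0}
      with hS
    have hSm : MeasurableSet S := by
      have hc : Continuous fun z : (Fin n → ℝ) × ℝ =>
          MvPolynomial.eval (Fin.cons z.2 z.1 : Fin (n + 1) → ℝ) p := by
        apply (MvPolynomial.continuous_eval p).comp
        apply continuous_pi
        intro i
        refine Fin.cases ?_ (fun j => ?_) i
        · simpa using continuous_snd
        · simpa using! (continuous_apply j).comp continuous_fst
      exact (isClosed_singleton.preimage hc).measurableSet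
    have hS0 : ((volume : Measure (Fin n → ℝ)).prod (volume : Measure ℝ)) S = 0 := by
      rw [Measure.measure_prod_null hSm]
      have hae : ∀ᵐ y : Fin n → ℝ, ¬ MvPolynomial.eval y f.leadingCoeff = 0 := by
        rw [ae_iff]
        simpa using hlead
      filter_upwards [hae] with y hy
      have hne : f.map (MvPolynomial.eval y) ≠ 0 := by
        intro h0
        apply hy
        have := congrArg (fun q => q.coeff f.natDegree) h0
        simpa [Polynomial.coeff_map] using this
      have hsub : Prod.mk y ⁻¹' S ⊆ {t | (f.map (MvPolynomial.eval y)).IsRoot t} := by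
        intro t ht
        simp only [hS, Set.mem_preimage, Set.mem_ofPred_eq,
          MvPolynomial.eval_eq_eval_mv_eval'] at ht
        exact ht
      exact measure_mono_null hsub ((Polynomial.finite_setOfPred_isRoot hne).measure_zero _)
    have hsw : (volume : Measure (ℝ × (Fin n → ℝ))) (Prod.swap ⁻¹' S) = 0 := by
      rw [Measure.volume_eq_prod,
        (Measure.measurePreserving_swap).measure_preimage hSm.nullMeasurableSet]
      exact hS0
    have hmp := volume_preserving_piFinSuccAbove (fun _ : Fin (n + 1) => ℝ) 0
    have hpre : {x : Fin (n + 1) → ℝ | MvPolynomial.eval x p = 0} =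
        (MeasurableEquiv.piFinSuccAbove (fun _ : Fin (n + 1) => ℝ) 0) ⁻¹' (Prod.swap ⁻¹' S) := by
      ext x
      have hx : (Fin.cons (x 0) (fun j => x (Fin.succ j)) : Fin (n + 1) → ℝ) = x :=
        Fin.cons_self_tail x
      simp only [Set.mem_ofPred_eq, Set.mem_preimage, hS]
      constructor
      · intro h
        rw [← hx] at h
        exact h
      · intro h
        rw [← hx]
        exact h
    rw [hpre, hmp.measure_preimage (measurable_swap hSm).nullMeasurableSet]
    exact hsw

/-- The zero set of a nonzero real polynomial in finitely many variables is a null set. -/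
theorem volume_zeroSet {ι : Type} [Fintype ι] (p : MvPolynomial ι ℝ) (hp : p ≠ 0) :
    volume {x : ι → ℝ | MvPolynomial.eval x p = 0} = 0 := by
  let e := Fintype.equivFin ι
  have hq : MvPolynomial.rename e p ≠ 0 := by
    rw [Ne, MvPolynomial.rename_eq_zero_iff_of_injective _ e.injective]
    exact hp
  have h0 := volume_zeroSet_fin _ _ hq
  have hmp := volume_measurePreserving_piCongrLeft (fun _ : Fin (Fintype.card ι) => ℝ) e
  have hpre : {x : ι → ℝ | MvPolynomial.eval x p = 0} =
      (MeasurableEquiv.piCongrLeft (fun _ : Fin (Fintype.card ι) => ℝ) e) ⁻¹'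
        {x | MvPolynomial.eval x (MvPolynomial.rename e p) = 0} := by
    ext x
    have : (MeasurableEquiv.piCongrLeft (fun _ : Fin (Fintype.card ι) => ℝ) e x) ∘ e = x := by
      funext i
      exact Equiv.piCongrLeft_apply_apply (fun _ : Fin (Fintype.card ι) => ℝ) e x i
    simp only [Set.mem_ofPred_eq, Set.mem_preimage, MvPolynomial.eval_rename, this]
  have hm : MeasurableSet {x : Fin (Fintype.card ι) → ℝ |
      MvPolynomial.eval x (MvPolynomial.rename e p) = 0} :=
    (isClosed_singleton.preimage (MvPolynomial.continuous_eval _)).measurableSet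
  rw [hpre, hmp.measure_preimage hm.nullMeasurableSet]
  exact h0

theorem isGeneric_of_polynomial {ι : Type} [Fintype ι] {P : (ι → ℝ) → Prop}
    (p : MvPolynomial ι ℝ) (hp : p ≠ 0) (h : ∀ θ, ¬ P θ → MvPolynomial.eval θ p = 0) :
    IsGeneric P :=
  ⟨p, hp, volume_zeroSet p hp, h⟩

theorem IsGeneric.mono {ι : Type} [Fintype ι] {P Q : (ι → ℝ) → Prop} (hP : IsGeneric P)
    (h : ∀ θ, P θ → Q θ) : IsGeneric Q := by
  obtain ⟨p, hp, hv, hz⟩ := hP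
  exact ⟨p, hp, hv, fun θ hθ => hz θ fun hPθ => hθ (h θ hPθ)⟩

theorem IsGeneric.and {ι : Type} [Fintype ι] {P Q : (ι → ℝ) → Prop} (hP : IsGeneric P)
    (hQ : IsGeneric Q) : IsGeneric fun θ => P θ ∧ Q θ := by
  obtain ⟨p, hp, -, hpz⟩ := hP
  obtain ⟨q, hq, -, hqz⟩ := hQ
  refine isGeneric_of_polynomial (p * q) (mul_ne_zero hp hq) fun θ hθ => ?_
  rw [map_mul, mul_eq_zero]
  by_cases h : P θ
  · exact Or.inr (hqz θ fun h' => hθ ⟨h, h'⟩)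
  · exact Or.inl (hpz θ h)

theorem IsGeneric.forall {ι κ : Type} [Fintype ι] [Finite κ] {P : κ → (ι → ℝ) → Prop}
    (hP : ∀ k, IsGeneric (P k)) : IsGeneric fun θ => ∀ k, P k θ := by
  have := Fintype.ofFinite κ
  choose p hp _ hz using hP
  refine isGeneric_of_polynomial (∏ k, p k) (Finset.prod_ne_zero_iff.2 fun k _ => hp k)
    fun θ hθ => ?_
  obtain ⟨k, hk⟩ := not_forall.1 hθ
  rw [map_prod]
  exact Finset.prod_eq_zero (Finset.mem_univ k) (hz k θ hk)

/-! ### Observability as a polynomial condition -/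

theorem det_ne_zero_of_rank_eq_card {σ : Type} [Fintype σ] [DecidableEq σ] (M : Matrix σ σ ℝ)
    (h : M.rank = Fintype.card σ) : M.det ≠ 0 := by
  have htop : LinearMap.range M.mulVecLin = ⊤ := by
    apply Submodule.eq_top_of_finrank_eq
    rw [Module.finrank_fintype_fun_eq_card]
    exact h
  have hs : Function.Surjective M.mulVec := LinearMap.range_eq_top.1 htop
  exact ((Matrix.isUnit_iff_isUnit_det _).1 (Matrix.mulVec_surjective_iff_isUnit.1 hs)).ne_zero

/-- A real matrix and its Gram matrix have the same rank, so full rank of a rectangular matrix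
becomes the nonvanishing of a single polynomial in the entries. -/
theorem observable_iff_det_ne_zero {σ κ : Type} [Fintype σ] [DecidableEq σ] [Fintype κ]
    (F : Matrix σ σ ℝ) (H : Matrix κ σ ℝ) :
    Observable F H ↔ (obsMatrix F H * (obsMatrix F H).transpose).det ≠ 0 := by
  unfold Observable
  rw [← Matrix.rank_self_mul_transpose]
  constructor
  · intro h
    exact det_ne_zero_of_rank_eq_card _ h
  · intro h
    exact Matrix.rank_of_isUnit _ ((Matrix.isUnit_iff_isUnit_det _).2 (isUnit_iff_ne_zero.2 h))

/-- If the entries of `F` and `H` are polynomials in the parameters, and the pair is observable for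
one choice of the parameters, then it is generically observable. -/
theorem isGeneric_observable {ι σ κ : Type} [Fintype ι] [Fintype σ] [DecidableEq σ] [Fintype κ]
    {F : (ι → ℝ) → Matrix σ σ ℝ} {H : (ι → ℝ) → Matrix κ σ ℝ}
    (FP : Matrix σ σ (MvPolynomial ι ℝ)) (HP : Matrix κ σ (MvPolynomial ι ℝ))
    (hF : ∀ θ, FP.map (MvPolynomial.eval θ) = F θ) (hH : ∀ θ, HP.map (MvPolynomial.eval θ) = H θ)
    (θ₀ : ι → ℝ) (h₀ : Observable (F θ₀) (H θ₀)) :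
    IsGeneric fun θ => Observable (F θ) (H θ) := by
  let OP : Matrix σ (Fin (Fintype.card σ) × κ) (MvPolynomial ι ℝ) :=
    Matrix.of fun s tk => ((FP ^ (tk.1 : ℕ)).transpose * HP.transpose) s tk.2
  have hO : ∀ θ, OP.map (MvPolynomial.eval θ) = obsMatrix (F θ) (H θ) := by
    intro θ
    ext s tk
    have hpow : (FP ^ (tk.1 : ℕ)).map (MvPolynomial.eval θ) = F θ ^ (tk.1 : ℕ) := by
      rw [← hF θ]
      exact map_pow (MvPolynomial.eval θ).mapMatrix FP _
    have := congrFun (congrFun (Matrix.map_mul (L := (FP ^ (tk.1 : ℕ)).transpose)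
      (M := HP.transpose) (f := MvPolynomial.eval θ)) s) tk.2
    rw [Matrix.transpose_map, Matrix.transpose_map, hpow, hH] at this
    exact this
  have hdet : ∀ θ, MvPolynomial.eval θ (OP * OP.transpose).det =
      (obsMatrix (F θ) (H θ) * (obsMatrix (F θ) (H θ)).transpose).det := by
    intro θ
    rw [RingHom.map_det, RingHom.mapMatrix_apply, Matrix.map_mul, Matrix.transpose_map, hO]
  refine isGeneric_of_polynomial (OP * OP.transpose).det ?_ ?_
  · intro h
    apply (observable_iff_det_ne_zero _ _).1 h₀
    rw [← hdet, h, map_zero]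
  · intro θ hθ
    rw [observable_iff_det_ne_zero, not_not] at hθ
    rw [hdet, hθ]

theorem observable_iff_forall {σ κ : Type} [Fintype σ] [DecidableEq σ] [Fintype κ]
    (F : Matrix σ σ ℝ) (H : Matrix κ σ ℝ) :
    Observable F H ↔ ∀ x : σ → ℝ,
      (∀ t < Fintype.card σ, H.mulVec ((F ^ t).mulVec x) = 0) → x = 0 := by
  have key : ∀ x : σ → ℝ, (obsMatrix F H * (obsMatrix F H).transpose).mulVec x = 0 ↔
      ∀ t < Fintype.card σ, H.mulVec ((F ^ t).mulVec x) = 0 := by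
    intro x
    have h1 := Matrix.self_mul_conjTranspose_mulVec_eq_zero (obsMatrix F H) x
    rw [Matrix.conjTranspose_eq_transpose_of_trivial] at h1
    rw [h1]
    have h2 : ∀ tk : Fin (Fintype.card σ) × κ, (obsMatrix F H).transpose.mulVec x tk =
        H.mulVec ((F ^ (tk.1 : ℕ)).mulVec x) tk.2 := by
      intro tk
      rw [Matrix.mulVec_mulVec]
      have : H * F ^ (tk.1 : ℕ) = ((F ^ (tk.1 : ℕ)).transpose * H.transpose).transpose := by
        rw [Matrix.transpose_mul, Matrix.transpose_transpose, Matrix.transpose_transpose]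
      rw [this]
      rfl
    constructor
    · intro h t ht
      funext k
      rw [← h2 (⟨t, ht⟩, k), h]
      rfl
    · intro h
      funext tk
      rw [h2, h tk.1 tk.1.2]
      rfl
  rw [observable_iff_det_ne_zero]
  constructor
  · intro h x hx
    exact Matrix.eq_zero_of_mulVec_eq_zero h ((key x).2 hx)
  · intro h h0
    obtain ⟨v, hv, hv0⟩ := Matrix.exists_mulVec_eq_zero_iff.2 h0
    exact hv (h v ((key v).1 hv0))

/-- The unobservable vectors are those annihilated by all powers. -/
theorem mulVec_pow_eq_zero {σ κ : Type} [Fintype σ] [DecidableEq σ]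
    (F : Matrix σ σ ℝ) (H : Matrix κ σ ℝ) (x : σ → ℝ)
    (hx : ∀ t < Fintype.card σ, H.mulVec ((F ^ t).mulVec x) = 0) (t : ℕ) :
    H.mulVec ((F ^ t).mulVec x) = 0 := by
  -- With no states the characteristic polynomial is 1 and the strict degree bound on the remainder
  -- below fails. Otherwise this is Cayley–Hamilton.
  rcases isEmpty_or_nonempty σ with hσ | hσ
  · rw [Subsingleton.elim ((F ^ t).mulVec x) 0, Matrix.mulVec_zero]
  rw [Matrix.pow_eq_aeval_mod_charpoly, Polynomial.aeval_eq_sum_range' (n := Fintype.card σ)]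
  · rw [Matrix.sum_mulVec, Matrix.mulVec_sum]
    refine Finset.sum_eq_zero fun i hi => ?_
    rw [Matrix.smul_mulVec, Matrix.mulVec_smul, hx i (Finset.mem_range.1 hi), smul_zero]
  · rw [← Matrix.charpoly_natDegree_eq_dim F]
    apply Polynomial.natDegree_modByMonic_lt _ F.charpoly_monic
    intro h1
    have := Matrix.charpoly_natDegree_eq_dim F
    rw [h1, Polynomial.natDegree_one] at this
    exact Fintype.card_ne_zero this.symm

/-! ### The eigenvector test over the complex numbers -/

/-- The complexification of a real matrix. -/
noncomputable abbrev toComplex {m n : Type} (M : Matrix m n ℝ) : Matrix m n ℂ :=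
  M.map Complex.ofRealHom

theorem toComplex_mulVec_ofReal {m n : Type} [Fintype n] (M : Matrix m n ℝ) (x : n → ℝ) :
    (toComplex M).mulVec (fun i => (x i : ℂ)) = fun i => ((M.mulVec x i : ℝ) : ℂ) := by
  funext i
  simp [Matrix.mulVec, dotProduct]

theorem re_toComplex_mulVec {m n : Type} [Fintype n] (M : Matrix m n ℝ) (x : n → ℂ) (i : m) :
    ((toComplex M).mulVec x i).re = M.mulVec (fun j => (x j).re) i := by
  simp [Matrix.mulVec, dotProduct]

theorem im_toComplex_mulVec {m n : Type} [Fintype n] (M : Matrix m n ℝ) (x : n → ℂ) (i : m) :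
    ((toComplex M).mulVec x i).im = M.mulVec (fun j => (x j).im) i := by
  simp [Matrix.mulVec, dotProduct]

theorem toComplex_pow {n : Type} [Fintype n] [DecidableEq n] (M : Matrix n n ℝ) (t : ℕ) :
    toComplex (M ^ t) = toComplex M ^ t :=
  map_pow Complex.ofRealHom.mapMatrix M t

/-- The Popov–Belevitch–Hautus eigenvector test, sufficiency. -/
theorem observable_of_eigenvector {σ κ : Type} [Fintype σ] [DecidableEq σ] [Fintype κ]
    (F : Matrix σ σ ℝ) (H : Matrix κ σ ℝ)
    (h : ∀ (μ : ℂ) (v : σ → ℂ), (toComplex F).mulVec v = μ • v → (toComplex H).mulVec v = 0 →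
      v = 0) : Observable F H := by
  rw [observable_iff_forall]
  intro x hx
  by_contra hx0
  have hall := mulVec_pow_eq_zero F H x hx
  -- The complex unobservable subspace is invariant and nonzero, hence contains an eigenvector.
  let U : Submodule ℂ (σ → ℂ) :=
    ⨅ t : ℕ, LinearMap.ker (toComplex H * toComplex F ^ t).mulVecLin
  have hU : ∀ y, y ∈ U ↔ ∀ t, (toComplex H * toComplex F ^ t).mulVec y = 0 := by
    intro y
    simp [U, Submodule.mem_iInf]
  have hinv : ∀ y ∈ U, (toComplex F).mulVecLin y ∈ U := by
    intro y hy
    rw [hU] at hy ⊢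
    intro t
    rw [Matrix.mulVecLin_apply, Matrix.mulVec_mulVec, Matrix.mul_assoc, ← pow_succ]
    exact hy (t + 1)
  let xc : σ → ℂ := fun i => (x i : ℂ)
  have hxU : xc ∈ U := by
    rw [hU]
    intro t
    rw [← toComplex_pow, ← Matrix.mulVec_mulVec, toComplex_mulVec_ofReal, toComplex_mulVec_ofReal,
      hall t]
    funext i
    simp
  have hxc : xc ≠ 0 := by
    intro h0
    apply hx0
    funext i
    have := congrFun h0 i
    simpa [xc] using this
  have : Nontrivial U := ⟨⟨⟨xc, hxU⟩, 0, fun h0 => hxc (congrArg Subtype.val h0)⟩⟩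
  obtain ⟨μ, hμ⟩ := Module.End.exists_eigenvalue ((toComplex F).mulVecLin.restrict hinv)
  obtain ⟨v, hv⟩ := hμ.exists_hasEigenvector
  have hv1 : (toComplex F).mulVec (v : σ → ℂ) = μ • (v : σ → ℂ) := by
    have := congrArg Subtype.val hv.apply_eq_smul
    simpa using this
  have hv2 := (hU v).1 v.2 0
  rw [pow_zero, Matrix.mul_one] at hv2
  exact hv.2 (Subtype.ext (h μ v hv1 hv2))

/-- The Popov–Belevitch–Hautus eigenvector test, necessity. -/
theorem Observable.eigenvector_eq_zero {σ κ : Type} [Fintype σ] [DecidableEq σ] [Fintype κ]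
    {F : Matrix σ σ ℝ} {H : Matrix κ σ ℝ} (h : Observable F H) {μ : ℂ} {v : σ → ℂ}
    (hF : (toComplex F).mulVec v = μ • v) (hH : (toComplex H).mulVec v = 0) : v = 0 := by
  rw [observable_iff_forall] at h
  have hpow : ∀ t : ℕ, (toComplex (F ^ t)).mulVec v = μ ^ t • v := by
    intro t
    rw [toComplex_pow]
    induction t with
    | zero => simp
    | succ t ih =>
      rw [pow_succ, ← Matrix.mulVec_mulVec, hF, Matrix.mulVec_smul, ih, smul_smul, pow_succ,
        mul_comm]
  have hall : ∀ t : ℕ, (toComplex H).mulVec ((toComplex (F ^ t)).mulVec v) = 0 := by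
    intro t
    rw [hpow, Matrix.mulVec_smul, hH, smul_zero]
  -- Since `F` and `H` are real, the real and imaginary parts of `v` are separately unobservable.
  have hre := h (fun i => (v i).re) fun t _ => by
    funext k
    have := congrArg Complex.re (congrFun (hall t) k)
    rw [re_toComplex_mulVec] at this
    simpa only [re_toComplex_mulVec] using! this
  have him := h (fun i => (v i).im) fun t _ => by
    funext k
    have := congrArg Complex.im (congrFun (hall t) k)
    rw [im_toComplex_mulVec] at this
    simpa only [im_toComplex_mulVec] using! this
  funext i
  exact Complex.ext (congrFun hre i) (congrFun him i)

/-! ### Eigenvectors of linked weighted cycles -/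

open Classical in
/-- The eigenvector equation of a weighted permutation whose cycles are linked by a forest of
single edges `src c → tgt c`, one for each cycle that is not a root: an eigenvector vanishes nowhere
on exactly one root cycle, and vanishes on the other root cycles. -/
theorem exists_root_of_cycle_forest {V ι : Type} [Fintype V] [Fintype ι]
    (σ : Equiv.Perm V) (cyc : V → ι) (hcyc : ∀ x, cyc (σ x) = cyc x)
    (hpow : ∀ x y, cyc x = cyc y → ∃ k : ℕ, (σ ^ k) x = y)
    (α : ι → ℝ) (hpos : ∀ c, 0 < α c) (hinj : Function.Injective α)
    (root : ι → Prop) (src tgt : ι → V) (hsrc : ∀ c, ¬ root c → cyc (src c) = c)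
    (D : ι → ℕ) (hD : ∀ c, ¬ root c → D (cyc (tgt c)) < D c)
    (μ : ℂ) (v : V → ℂ) (hv : v ≠ 0)
    (heq : ∀ y, μ * v (σ y) = α (cyc y) * v y +
      ∑ c, if ¬ root c ∧ tgt c = σ y then v (src c) else 0) :
    ∃ r, root r ∧ (∀ x, cyc x = r → v x ≠ 0) ∧ ∀ x, root (cyc x) → v x ≠ 0 → cyc x = r := by
  have hαne : ∀ c, (α c : ℂ) ≠ 0 := fun c => Complex.ofReal_ne_zero.2 (hpos c).ne'
  -- `T` marks the cycles meeting the support of `v`, and `Step` follows the unique link out of a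
  -- non-root cycle.
  let T : ι → Prop := fun c => ∃ x, cyc x = c ∧ v x ≠ 0
  let Step : ι → ι → Prop := fun c c' => ¬ root c ∧ cyc (tgt c) = c'
  have hStepD : ∀ c c', Relation.ReflTransGen Step c c' → D c' ≤ D c := by
    intro c c' h
    induction h with
    | refl => exact le_rfl
    | tail _ hs ih =>
      obtain ⟨h1, rfl⟩ := hs
      exact (hD _ h1).le.trans ih
  have hRU : Relator.RightUnique Step := by
    intro a b c hb hc
    rw [← hb.2, hc.2]
  -- A leaf receives nothing from the support, so the equation on it is homogeneous; iterating
  -- `orderOf σ` times gives `‖μ‖ = α c`.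
  let Leaf : ι → Prop := fun c => T c ∧ ∀ d, Step d c → ¬ T d
  have hleafeq : ∀ c, Leaf c → ∀ y, cyc y = c → μ * v (σ y) = α c * v y := by
    intro c hc y hy
    rw [heq y, hy, Finset.sum_eq_zero, add_zero]
    intro d _
    split_ifs with hd
    · by_contra hne
      exact hc.2 d ⟨hd.1, by rw [hd.2, hcyc, hy]⟩ ⟨src d, hsrc d hd.1, hne⟩
    · rfl
  have hcyck : ∀ (k : ℕ) x, cyc ((σ ^ k) x) = cyc x := by
    intro k x
    induction k with
    | zero => rfl
    | succ k ih => rw [pow_succ', Equiv.Perm.mul_apply, hcyc, ih]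
  have hleafnorm : ∀ c, Leaf c → ‖μ‖ = α c := by
    intro c hc
    obtain ⟨x, hx, hvx⟩ := hc.1
    have hit : ∀ k : ℕ, μ ^ k * v ((σ ^ k) x) = (α c : ℂ) ^ k * v x := by
      intro k
      induction k with
      | zero => simp
      | succ k ih =>
        have := hleafeq c hc ((σ ^ k) x) (by rw [hcyck, hx])
        rw [pow_succ' σ, Equiv.Perm.mul_apply, pow_succ μ, mul_assoc, this, pow_succ']
        linear_combination (α c : ℂ) * ih
    have h1 := hit (orderOf σ)
    rw [pow_orderOf_eq_one, Equiv.Perm.one_apply] at h1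
    have h2 := congrArg norm (mul_right_cancel₀ hvx h1)
    rw [norm_pow, norm_pow, Complex.norm_real, Real.norm_of_nonneg (hpos c).le] at h2
    exact (pow_left_inj₀ (norm_nonneg _) (hpos c).le (orderOf_pos σ).ne').1 h2
  have hexleaf : ∀ c, T c → ∃ c₀, Leaf c₀ ∧ Relation.ReflTransGen Step c₀ c := by
    intro c hc
    obtain ⟨c₀, ⟨hT₀, hp₀⟩, hmax⟩ := Set.exists_max_image
      {d | T d ∧ Relation.ReflTransGen Step d c} D (Set.toFinite _) ⟨c, hc, .refl⟩
    refine ⟨c₀, ⟨hT₀, fun d hd hTd => ?_⟩, hp₀⟩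
    have h1 := hmax d ⟨hTd, .head hd hp₀⟩
    have h2 := hD d hd.1
    rw [hd.2] at h2
    omega
  obtain ⟨x₀, hx₀⟩ := Function.ne_iff.1 hv
  obtain ⟨c₀, hc₀, -⟩ := hexleaf (cyc x₀) ⟨x₀, rfl, hx₀⟩
  have hμ : μ ≠ 0 := by
    rw [← norm_pos_iff, hleafnorm c₀ hc₀]
    exact hpos c₀
  -- Distinct weights allow only one leaf, so the whole support lies on the single chain of cycles
  -- starting at `c₀`.
  have hTreach : ∀ c, T c → Relation.ReflTransGen Step c₀ c := by
    intro c hc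
    obtain ⟨c₁, hc₁, hp⟩ := hexleaf c hc
    have : c₀ = c₁ := hinj (by rw [← hleafnorm c₀ hc₀, ← hleafnorm c₁ hc₁])
    rwa [this]
  have hNV : ∀ c, Relation.ReflTransGen Step c₀ c → ∀ x, cyc x = c → v x ≠ 0 := by
    intro c hc
    induction hc with
    | refl =>
      intro z hz
      obtain ⟨x, hx, hvx⟩ := hc₀.1
      obtain ⟨k, rfl⟩ := hpow x z (by rw [hx, hz])
      clear hz
      induction k with
      | zero => exact hvx
      | succ k ih =>
        intro h0
        have := hleafeq c₀ hc₀ ((σ ^ k) x) (by rw [hcyck, hx])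
        rw [← Equiv.Perm.mul_apply, ← pow_succ', h0, mul_zero] at this
        exact mul_ne_zero (hαne c₀) ih this.symm
    | @tail b c hb hs ih =>
      have hs0 : v (src b) ≠ 0 := ih _ (hsrc b hs.1)
      have hTb : T b := ⟨src b, hsrc b hs.1, hs0⟩
      -- Two supported cycles feeding `c` would be comparable on the chain, so one would be reached
      -- from `c`, against the decrease of `D`.
      have huniq : ∀ d, d ≠ b → Step d c → ¬ T d := by
        have haux : ∀ d e, d ≠ e → Step d c → Step e c → Relation.ReflTransGen Step d e →
            False := by
          intro d e hne hd he hde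
          rcases Relation.ReflTransGen.cases_head hde with h | ⟨f, hf, hfe⟩
          · exact hne h
          · rw [hRU hf hd] at hfe
            have h1 := hStepD _ _ hfe
            have h2 := hD e he.1
            rw [he.2] at h2
            omega
        intro d hne hd hTd
        rcases Relation.ReflTransGen.total_of_right_unique hRU (hTreach d hTd) hb with h | h
        · exact haux d b hne hd hs h
        · exact haux b d hne.symm hs hd h
      have heqc : ∀ y, cyc y = c → μ * v (σ y) = α c * v y +
          if tgt b = σ y then v (src b) else 0 := by
        intro y hy
        rw [heq y, hy, Finset.sum_eq_single b]
        · simp only [hs.1, not_false_eq_true, true_and]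
        · intro d _ hdb
          split_ifs with hd
          · by_contra hne
            exact huniq d hdb ⟨hd.1, by rw [hd.2, hcyc, hy]⟩ ⟨src d, hsrc d hd.1, hne⟩
          · rfl
        · intro h
          exact absurd (Finset.mem_univ b) h
      -- A zero at the entry point would propagate once around the cycle and force the incoming
      -- value `v (src b)` to vanish.
      have hty : v (tgt b) ≠ 0 := by
        intro h0
        have hall : ∀ k : ℕ, v ((σ ^ k) (tgt b)) = 0 := by
          intro k
          induction k with
          | zero => exact h0
          | succ k ihk =>
            have := heqc ((σ ^ k) (tgt b)) (by rw [hcyck, hs.2])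
            rw [ihk, ← Equiv.Perm.mul_apply, ← pow_succ', mul_zero, zero_add] at this
            by_cases h : tgt b = (σ ^ (k + 1)) (tgt b)
            · rw [← h, h0]
            · rw [if_neg h] at this
              exact (mul_eq_zero.1 this).resolve_left hμ
        obtain ⟨k, hk⟩ := hpow (tgt b) (σ.symm (tgt b)) (by
          rw [← hcyc (σ.symm (tgt b)), Equiv.apply_symm_apply])
        have h1 := heqc (σ.symm (tgt b)) (by
          rw [← hcyc (σ.symm (tgt b)), Equiv.apply_symm_apply, hs.2])
        rw [Equiv.apply_symm_apply, if_pos rfl, h0, ← hk, hall k, mul_zero, mul_zero,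
          zero_add] at h1
        exact hs0 h1.symm
      intro z hz
      obtain ⟨k, rfl⟩ := hpow (tgt b) z (by rw [hs.2, hz])
      clear hz
      induction k with
      | zero => exact hty
      | succ k ihk =>
        by_cases h : tgt b = (σ ^ (k + 1)) (tgt b)
        · rwa [← h]
        · intro h0
          have := heqc ((σ ^ k) (tgt b)) (by rw [hcyck, hs.2])
          rw [← Equiv.Perm.mul_apply, ← pow_succ', h0, if_neg h, mul_zero, add_zero] at this
          exact mul_ne_zero (hαne c) ihk this.symm
  obtain ⟨r, hr, hmin⟩ := Set.exists_min_image {c | Relation.ReflTransGen Step c₀ c} D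
    (Set.toFinite _) ⟨c₀, .refl⟩
  have hroot : root r := by
    by_contra h
    have h1 := hmin (cyc (tgt r)) (Relation.ReflTransGen.tail hr ⟨h, rfl⟩)
    have h2 := hD r h
    omega
  have hfinal : ∀ c c', root c → Relation.ReflTransGen Step c c' → c = c' := by
    intro c c' hc h
    rcases Relation.ReflTransGen.cases_head h with h | ⟨f, hf, -⟩
    · exact h
    · exact absurd hc hf.1
  refine ⟨r, hroot, hNV r hr, fun x hx hvx => ?_⟩
  rcases Relation.ReflTransGen.total_of_right_unique hRU (hTreach _ ⟨x, rfl, hvx⟩) hr with h | h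
  · exact hfinal _ _ hx h
  · exact (hfinal _ _ hroot h).symm

/-- If every vertex has a path to a target set, every vertex off the set has a successor
that is strictly closer to it. -/
theorem exists_distance {ι : Type} (E : ι → ι → Prop) (root : ι → Prop)
    (h : ∀ c, ∃ r, root r ∧ Relation.ReflTransGen E c r) :
    ∃ D : ι → ℕ, ∀ c, ¬ root c → ∃ c', E c c' ∧ D c' < D c := by
  -- `reach k c` means that a walk of exactly `k` edges leads from `c` to a root.
  let reach : ℕ → ι → Prop := fun k => Nat.rec root (fun _ P c => ∃ c', E c c' ∧ P c') k
  have hex : ∀ c, ∃ k, reach k c := by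
    intro c
    obtain ⟨r, hr, hp⟩ := h c
    induction hp using Relation.ReflTransGen.head_induction_on with
    | refl => exact ⟨0, hr⟩
    | head hs _ ih =>
      obtain ⟨k, hk⟩ := ih
      exact ⟨k + 1, _, hs, hk⟩
  have hmin : ∀ c, ∃ k, reach k c ∧ ∀ m, reach m c → k ≤ m :=
    fun c => ⟨sInf {k | reach k c}, Nat.sInf_mem (hex c), fun m hm => Nat.sInf_le hm⟩
  choose D hreach hmin using hmin
  refine ⟨D, fun c hc => ?_⟩
  have hspec := hreach c
  rcases hk : D c with _ | k
  · rw [hk] at hspec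
    exact absurd hspec hc
  · rw [hk] at hspec
    obtain ⟨c', hE, hc'⟩ := hspec
    exact ⟨c', hE, Nat.lt_succ_of_le (hmin c' k hc')⟩

/-- The cycle of a permutation that contains a given point. -/
abbrev cycleClass {V : Type} (σ : Equiv.Perm V) (x : V) :
    Quotient (Equiv.Perm.SameCycle.setoid σ) :=
  Quotient.mk (Equiv.Perm.SameCycle.setoid σ) x

theorem cycleClass_eq_iff {V : Type} (σ : Equiv.Perm V) (x y : V) :
    cycleClass σ x = cycleClass σ y ↔ σ.SameCycle x y :=
  Quotient.eq (r := Equiv.Perm.SameCycle.setoid σ)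

theorem cycleClass_apply {V : Type} (σ : Equiv.Perm V) (x : V) :
    cycleClass σ (σ x) = cycleClass σ x :=
  (cycleClass_eq_iff σ _ _).2 (Equiv.Perm.sameCycle_apply_left.2 (Equiv.Perm.SameCycle.refl σ x))

theorem exists_pow_of_cycleClass_eq {V : Type} [Finite V] (σ : Equiv.Perm V) (x y : V)
    (h : cycleClass σ x = cycleClass σ y) : ∃ k : ℕ, (σ ^ k) x = y :=
  ((cycleClass_eq_iff σ x y).1 h).exists_nat_pow_eq

/-- A perfect matching (a permutation supported on the pattern of `M`) together with paths to a set
`R` of vertices yields a matrix with the pattern of `M` each of whose eigenvectors is nonzero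
somewhere on `R`, and on a single cycle only. -/
theorem exists_matrix_eigenvector_ne_zero {V : Type} [Fintype V] [DecidableEq V]
    (M : Matrix V V ℝ) (σ : Equiv.Perm V) (hσ : ∀ x, M (σ x) x ≠ 0) (R : Set V)
    (hR : ∀ x, ∃ r ∈ R, HasPath M x r) :
    ∃ B : Matrix V V ℝ, (∀ x y, B x y ≠ 0 → M x y ≠ 0) ∧
      ∀ (μ : ℂ) (v : V → ℂ), (toComplex B).mulVec v = μ • v → v ≠ 0 →
        ∃ r ∈ R, v r ≠ 0 ∧ ∀ r' ∈ R, v r' ≠ 0 → σ.SameCycle r r' := by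
  classical
  let ι := Quotient (Equiv.Perm.SameCycle.setoid σ)
  let cyc : V → ι := cycleClass σ
  have : Fintype ι := Fintype.ofFinite ι
  let root : ι → Prop := fun c => ∃ r ∈ R, cyc r = c
  let E : ι → ι → Prop := fun c c' => ∃ x y, cyc x = c ∧ cyc y = c' ∧ Edge M x y
  obtain ⟨D, hD⟩ := exists_distance E root (by
    intro c
    obtain ⟨x, rfl⟩ := Quotient.exists_rep c
    obtain ⟨r, hr, hp⟩ := hR x
    refine ⟨cyc r, ⟨r, hr, rfl⟩, ?_⟩
    exact hp.lift cyc fun a b hab => ⟨a, b, rfl, rfl, hab⟩)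
  -- The implication makes `src` and `tgt` total; their values on root cycles are arbitrary and
  -- never used.
  have hE : ∀ c, ∃ x y, ¬ root c → cyc x = c ∧ Edge M x y ∧ D (cyc y) < D c := by
    intro c
    by_cases hc : root c
    · obtain ⟨x, -⟩ := Quotient.exists_rep c
      exact ⟨x, x, fun h => absurd hc h⟩
    · obtain ⟨c', ⟨x, y, hx, hy, he⟩, hlt⟩ := hD c hc
      exact ⟨x, y, fun _ => ⟨hx, he, by rwa [hy]⟩⟩
  choose src tgt hst using hE
  let α : ι → ℝ := fun c => (Fintype.equivFin ι c : ℕ) + 1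
  have hpos : ∀ c, 0 < α c := fun c => by positivity
  have hinj : Function.Injective α := by
    intro a b hab
    have h1 : ((Fintype.equivFin ι a : ℕ) : ℝ) = (Fintype.equivFin ι b : ℕ) := add_right_cancel hab
    exact (Fintype.equivFin ι).injective (Fin.ext (Nat.cast_injective h1))
  let B : Matrix V V ℝ := Matrix.of fun y x =>
    (if y = σ x then α (cyc x) else 0) + ∑ c, if ¬ root c ∧ tgt c = y ∧ src c = x then 1 else 0
  refine ⟨B, ?_, ?_⟩
  · intro y x hB hM
    apply hB
    have h1 : y ≠ σ x := by
      rintro rfl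
      exact hσ x hM
    simp only [B, Matrix.of_apply, if_neg h1, zero_add]
    refine Finset.sum_eq_zero fun c _ => if_neg ?_
    rintro ⟨hc, rfl, rfl⟩
    exact (hst c hc).2.1 hM
  · intro μ v hBv hv
    obtain ⟨r, ⟨r₀, hr₀, hr₀r⟩, hNV, huniq⟩ := exists_root_of_cycle_forest σ cyc
      (cycleClass_apply σ) (exists_pow_of_cycleClass_eq σ) α hpos hinj root src tgt
      (fun c hc => (hst c hc).1) D (fun c hc => (hst c hc).2.2) μ v hv (by
        intro y
        have h := congrFun hBv (σ y)
        rw [Pi.smul_apply, smul_eq_mul] at h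
        rw [← h]
        simp only [Matrix.mulVec, dotProduct, Matrix.map_apply, B, Matrix.of_apply, map_add,
          map_sum, add_mul, Finset.sum_add_distrib, Finset.sum_mul]
        congr 1
        · rw [Finset.sum_eq_single y]
          · simp
          · intro x _ hxy
            rw [if_neg fun h' => hxy (σ.injective h').symm]
            simp
          · intro h'
            exact absurd (Finset.mem_univ y) h'
        · rw [Finset.sum_comm]
          refine Finset.sum_congr rfl fun c _ => ?_
          rw [Finset.sum_eq_single (src c)]
          · by_cases h' : ¬ root c ∧ tgt c = σ y
            · rw [if_pos ⟨h'.1, h'.2, rfl⟩, if_pos h']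
              simp
            · rw [if_neg fun h'' => h' ⟨h''.1, h''.2.1⟩, if_neg h']
              simp
          · intro x _ hx
            rw [if_neg fun h'' => hx h''.2.2.symm]
            simp
          · intro h'
            exact absurd (Finset.mem_univ _) h')
    refine ⟨r₀, hr₀, hNV r₀ hr₀r, fun r' hr' hvr' => ?_⟩
    rw [← cycleClass_eq_iff]
    exact hr₀r.trans (huniq r' ⟨r', hr', rfl⟩ hvr').symm

/-! ### Filling a zero pattern -/

/-- The matrix with the zero pattern of `M` whose nonzero entries are polynomial variables. -/
noncomputable def fillPoly {m n ι : Type} (M : Matrix m n ℝ) (g : FreeEntry M → ι) :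
    Matrix m n (MvPolynomial ι ℝ) :=
  fun i j => open Classical in if h : M i j ≠ 0 then MvPolynomial.X (g ⟨(i, j), h⟩) else 0

theorem eval_fillPoly {m n ι : Type} (M : Matrix m n ℝ) (g : FreeEntry M → ι) (θ : ι → ℝ)
    (i : m) (j : n) :
    MvPolynomial.eval θ (fillPoly M g i j) = fill M (fun e => θ (g e)) i j := by
  unfold fillPoly fill
  rw [Matrix.of_apply]
  split_ifs
  · rw [MvPolynomial.eval_X]
  · rw [map_zero]

theorem fill_eq_of_support {m n : Type} (M B : Matrix m n ℝ)
    (h : ∀ i j, B i j ≠ 0 → M i j ≠ 0) : fill M (fun e => B e.1.1 e.1.2) = B := by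
  ext i j
  unfold fill
  rw [Matrix.of_apply]
  split_ifs with hM
  · rfl
  · by_contra hB
    exact hM (h i j (Ne.symm hB))

theorem support_of_fill {m n : Type} (M : Matrix m n ℝ) (θ : FreeEntry M → ℝ) (i : m) (j : n)
    (h : fill M θ i j ≠ 0) : M i j ≠ 0 := by
  intro h0
  apply h
  unfold fill
  rw [Matrix.of_apply, dif_neg (not_not.2 h0)]

/-- A matrix with full structural rank has a perfect matching. -/
theorem exists_perm_of_sRank {n : ℕ} (A : Matrix (Fin n) (Fin n) ℝ) (hA : sRank A = n) :
    ∃ σ : Equiv.Perm (Fin n), ∀ x, A (σ x) x ≠ 0 := by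
  have hmem := Nat.sSup_mem (Set.range_nonempty fun θ : FreeEntry A → ℝ => (fill A θ).rank)
    ⟨n, by
      rintro _ ⟨θ, rfl⟩
      simpa using Matrix.rank_le_card_width (fill A θ)⟩
  obtain ⟨θ, hθ⟩ := hmem
  have hrank : (fill A θ).rank = Fintype.card (Fin n) := by
    rw [Fintype.card_fin]
    exact hθ.trans hA
  have hdet := det_ne_zero_of_rank_eq_card _ hrank
  -- A nonzero term of the Leibniz expansion is the required permutation.
  rw [Matrix.det_apply] at hdet
  obtain ⟨σ, -, hσ⟩ := Finset.exists_ne_zero_of_sum_ne_zero hdet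
  refine ⟨σ, fun x => support_of_fill A θ _ _ fun h0 => hσ ?_⟩
  have h1 : ∏ i, fill A θ (σ i) i = 0 := Finset.prod_eq_zero (Finset.mem_univ x) h0
  rw [h1, smul_zero]

/-! ### Parent components -/

theorem IsSCC.eq_of_mem {V : Type} {M : Matrix V V ℝ} {K : Set V} (hK : IsSCC M K) {x : V}
    (hx : x ∈ K) : K = {b | HasPath M x b ∧ HasPath M b x} := by
  obtain ⟨a, rfl⟩ := hK
  ext b
  exact ⟨fun hb => ⟨hx.2.trans hb.1, hb.2.trans hx.1⟩, fun hb => ⟨hx.1.trans hb.1, hb.2.trans hx.2⟩⟩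

theorem IsParentSCC.mem_of_hasPath {V : Type} {M : Matrix V V ℝ} {K : Set V}
    (hK : IsParentSCC M K) {a b : V} (ha : a ∈ K) (h : HasPath M a b) : b ∈ K := by
  induction h with
  | refl => exact ha
  | tail _ hs ih => exact hK.2 _ ih _ hs

/-- Every vertex has a path to every vertex of some parent component. -/
theorem exists_parentSCC {V : Type} [Finite V] (M : Matrix V V ℝ) (x : V) :
    ∃ K, IsParentSCC M K ∧ ∀ y ∈ K, HasPath M x y := by
  -- A reachable vertex with the fewest descendants is itself reachable from each of them.
  obtain ⟨y, hy, hmin⟩ := Set.exists_min_image {y | HasPath M x y}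
    (fun y => {z | HasPath M y z}.ncard) (Set.toFinite _) ⟨x, .refl⟩
  refine ⟨{b | HasPath M y b ∧ HasPath M b y}, ⟨⟨y, rfl⟩, ?_⟩, fun z hz => hy.trans hz.1⟩
  intro a ha b hab
  have hyb : HasPath M y b := Relation.ReflTransGen.tail ha.1 hab
  refine ⟨hyb, ?_⟩
  have hsub : {z | HasPath M b z} ⊆ {z | HasPath M y z} := fun z hz => hyb.trans hz
  have heq := Set.eq_of_subset_of_ncard_le hsub (hmin b (hy.trans hyb)) (Set.toFinite _)
  have : y ∈ {z | HasPath M b z} := by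
    rw [heq]
    exact Relation.ReflTransGen.refl
  exact this

/-- Each `x → σ x` is an edge, so a cycle of the matching lies inside one strongly connected
component. -/
theorem hasPath_of_sameCycle {V : Type} [Finite V] {M : Matrix V V ℝ} {σ : Equiv.Perm V}
    (hσ : ∀ x, M (σ x) x ≠ 0) {x y : V} (h : σ.SameCycle x y) : HasPath M x y := by
  obtain ⟨k, rfl⟩ := h.exists_nat_pow_eq
  induction k with
  | zero => exact Relation.ReflTransGen.refl
  | succ k ih =>
    rw [pow_succ', Equiv.Perm.mul_apply]
    exact Relation.ReflTransGen.tail (ih ⟨k, rfl⟩) (hσ _)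

/-! ### Kronecker products with one-dimensional eigenspaces -/

/-- If `W ⊗ A` is observable from a single output, its eigenvectors are pure tensors. -/
theorem eigenvector_kronecker_eq_tensor {m n : Type} [Fintype m] [Fintype n] [DecidableEq m]
    [DecidableEq n] {W : Matrix m m ℝ} {A : Matrix n n ℝ} {h : Matrix Unit (m × n) ℝ}
    (hobs : Observable (W ⊗ₖ A) h) {ν : ℂ} {x : m × n → ℂ}
    (hx : (toComplex (W ⊗ₖ A)).mulVec x = ν • x) (hx0 : x ≠ 0) :
    ∃ (u : m → ℂ) (v : n → ℂ) (l μ : ℂ), (toComplex W).mulVec u = l • u ∧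
      (toComplex A).mulVec v = μ • v ∧ u ≠ 0 ∧ v ≠ 0 ∧ ∀ i j, x (i, j) = u i * v j := by
  set P : Matrix (m × n) (m × n) ℂ := toComplex W ⊗ₖ (1 : Matrix n n ℂ) with hP
  set Q : Matrix (m × n) (m × n) ℂ := (1 : Matrix m m ℂ) ⊗ₖ toComplex A with hQ
  have hWA : toComplex (W ⊗ₖ A) = toComplex W ⊗ₖ toComplex A := by
    ext i j
    simp
  have hPQ : P * Q = toComplex (W ⊗ₖ A) := by
    rw [hWA, hP, hQ, ← Matrix.mul_kronecker_mul, Matrix.mul_one, Matrix.one_mul]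
  have hQP : Q * P = toComplex (W ⊗ₖ A) := by
    rw [hWA, hP, hQ, ← Matrix.mul_kronecker_mul, Matrix.mul_one, Matrix.one_mul]
  have hPapp : ∀ (y : m × n → ℂ) i j, P.mulVec y (i, j) =
      (toComplex W).mulVec (fun k => y (k, j)) i := by
    intro y i j
    simp [hP, Matrix.mulVec, dotProduct, Fintype.sum_prod_type, Matrix.one_apply]
  have hQapp : ∀ (y : m × n → ℂ) i j, Q.mulVec y (i, j) =
      (toComplex A).mulVec (fun k => y (i, k)) j := by
    intro y i j
    simp [hQ, Matrix.mulVec, dotProduct, Fintype.sum_prod_type, Matrix.one_apply]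
  let f : (m × n → ℂ) → ℂ := fun y => (toComplex h).mulVec y ()
  have hf0 : ∀ y, f y = 0 → (toComplex h).mulVec y = 0 := by
    intro y hy
    funext i
    exact hy
  have hne : ∀ y, (toComplex (W ⊗ₖ A)).mulVec y = ν • y → y ≠ 0 → f y ≠ 0 := fun y hy hy0 h0 =>
    hy0 (hobs.eigenvector_eq_zero hy (hf0 y h0))
  have hfx := hne x hx hx0
  -- The output functional `f` vanishes on no eigenvector, so each eigenspace is a line; the
  -- commuting factors `P` and `Q` preserve it.
  have key : ∀ y, (toComplex (W ⊗ₖ A)).mulVec y = ν • y → f y • x = f x • y := by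
    intro y hy
    rw [← sub_eq_zero]
    refine hobs.eigenvector_eq_zero (μ := ν) ?_ (hf0 _ ?_)
    · rw [Matrix.mulVec_sub, Matrix.mulVec_smul, Matrix.mulVec_smul, hx, hy, smul_sub,
        smul_comm (f y), smul_comm (f x)]
    · simp only [f, Matrix.mulVec_sub, Matrix.mulVec_smul, Pi.sub_apply, Pi.smul_apply, smul_eq_mul]
      ring
  have hPx : P.mulVec x = (f (P.mulVec x) / f x) • x := by
    have h1 := key (P.mulVec x) (by
      nth_rw 1 [← hPQ]
      rw [Matrix.mulVec_mulVec, Matrix.mul_assoc, hQP, ← Matrix.mulVec_mulVec, hx,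
        Matrix.mulVec_smul])
    rw [div_eq_inv_mul, mul_smul, h1, smul_smul, inv_mul_cancel₀ hfx, one_smul]
  have hQx : Q.mulVec x = (f (Q.mulVec x) / f x) • x := by
    have h1 := key (Q.mulVec x) (by
      nth_rw 1 [← hQP]
      rw [Matrix.mulVec_mulVec, Matrix.mul_assoc, hPQ, ← Matrix.mulVec_mulVec, hx,
        Matrix.mulVec_smul])
    rw [div_eq_inv_mul, mul_smul, h1, smul_smul, inv_mul_cancel₀ hfx, one_smul]
  generalize f (P.mulVec x) / f x = l at hPx
  generalize f (Q.mulVec x) / f x = μ at hQx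
  have hν : ν = l * μ := by
    have h1 : ν • x = (l * μ) • x := by
      rw [← hx, ← hPQ, ← Matrix.mulVec_mulVec, hQx, Matrix.mulVec_smul, hPx, smul_smul, mul_comm]
    exact smul_left_injective ℂ hx0 h1
  obtain ⟨⟨a, b⟩, hab⟩ := Function.ne_iff.1 hx0
  have hu : (toComplex W).mulVec (fun i => x (i, b)) = l • fun i => x (i, b) := by
    funext i
    rw [← hPapp, hPx]
    rfl
  have hv : (toComplex A).mulVec (fun j => x (a, j)) = μ • fun j => x (a, j) := by
    funext j
    rw [← hQapp, hQx]
    rfl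
  -- The product of the column and the row of `x` through a nonzero entry lies on the same line, so
  -- `x` is proportional to it.
  let y : m × n → ℂ := fun ij => x (ij.1, b) * x (a, ij.2)
  have hPy : P.mulVec y = l • y := by
    funext ⟨i, j⟩
    rw [hPapp]
    have : (fun k => y (k, j)) = x (a, j) • fun k => x (k, b) := by
      funext k
      simp [y, mul_comm]
    rw [this, Matrix.mulVec_smul, hu]
    simp only [y, Pi.smul_apply, smul_eq_mul]
    ring
  have hQy : Q.mulVec y = μ • y := by
    funext ⟨i, j⟩
    rw [hQapp]
    have : (fun k => y (i, k)) = x (i, b) • fun k => x (a, k) := by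
      funext k
      simp [y]
    rw [this, Matrix.mulVec_smul, hv]
    simp only [y, Pi.smul_apply, smul_eq_mul]
    ring
  have hy : (toComplex (W ⊗ₖ A)).mulVec y = ν • y := by
    rw [← hPQ, ← Matrix.mulVec_mulVec, hQy, Matrix.mulVec_smul, hPy, smul_smul, hν, mul_comm]
  have hy0 : y ≠ 0 := fun h0 => mul_ne_zero hab hab (congrFun h0 (a, b))
  have hfy := hne y hy hy0
  refine ⟨(f x / f y) • fun i => x (i, b), fun j => x (a, j), l, μ, ?_, hv, ?_, ?_, ?_⟩
  · rw [Matrix.mulVec_smul, hu, smul_comm]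
  · intro h0
    exact mul_ne_zero (div_ne_zero hfx hfy) hab (congrFun h0 a)
  · intro h0
    exact hab (congrFun h0 b)
  · intro i j
    have h1 : f y * x (i, j) = f x * (x (i, b) * x (a, j)) := congrFun (key y hy) (i, j)
    change x (i, j) = f x / f y * x (i, b) * x (a, j)
    rw [div_mul_eq_mul_div, div_mul_eq_mul_div, eq_div_iff hfy]
    linear_combination h1

/-- The Kronecker product of a suitable diagonal matrix with a suitably weighted permutation matrix
is observable from a single output. -/
theorem exists_observable_diagonal_kronecker (N : ℕ) {n : ℕ} (σ : Equiv.Perm (Fin n)) :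
    ∃ (d : Fin N → ℝ) (a : Fin n → ℝ) (h : Matrix Unit (Fin N × Fin n) ℝ),
      Observable (Matrix.diagonal d ⊗ₖ Matrix.of fun y x => if y = σ x then a x else 0) h := by
  classical
  let κ := Quotient (Equiv.Perm.SameCycle.setoid σ)
  have : Fintype κ := Fintype.ofFinite κ
  let e := Fintype.equivFin κ
  let cyc : Fin N × Fin n → Fin N × κ := fun z => (z.1, cycleClass σ z.2)
  let rep : Fin N × κ → Fin N × Fin n := fun c => (c.1, c.2.out)
  have hrep : ∀ c, cyc (rep c) = c := fun c => Prod.ext rfl (Quotient.out_eq c.2)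
  -- The exponents number the pairs (agent, cycle) without repetition, so all product weights are
  -- distinct.
  let d : Fin N → ℝ := fun i => 2 ^ (Fintype.card κ * (i : ℕ))
  let a : κ → ℝ := fun c => 2 ^ (e c : ℕ)
  let α : Fin N × κ → ℝ := fun c => d c.1 * a c.2
  have hα : ∀ c, α c = 2 ^ (finProdFinEquiv (c.1, e c.2) : ℕ) := by
    intro c
    simp only [α, d, a, finProdFinEquiv_apply_val]
    rw [← pow_add, add_comm]
  have hinj : Function.Injective α := by
    intro c c' hcc
    rw [hα, hα] at hcc
    have h1 := finProdFinEquiv.injective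
      (Fin.ext (pow_right_injective₀ (by norm_num : (0 : ℝ) < 2) (by norm_num) hcc))
    rw [Prod.mk.injEq] at h1
    exact Prod.ext h1.1 (e.injective h1.2)
  refine ⟨d, fun x => a (cycleClass σ x), Matrix.of fun _ z => if rep (cyc z) = z then 1 else 0,
    ?_⟩
  refine observable_of_eigenvector _ _ fun μ v hv hh => ?_
  by_contra hv0
  let σ' : Equiv.Perm (Fin N × Fin n) := Equiv.prodCongr (Equiv.refl _) σ
  have hσ' : ∀ (k : ℕ) i x, (σ' ^ k) (i, x) = (i, (σ ^ k) x) := by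
    intro k i x
    induction k with
    | zero => rfl
    | succ k ih =>
      rw [pow_succ', Equiv.Perm.mul_apply, ih, pow_succ', Equiv.Perm.mul_apply]
      rfl
  obtain ⟨r, -, hNV, huniq⟩ := exists_root_of_cycle_forest σ' cyc
    (fun z => Prod.ext rfl (cycleClass_apply σ z.2))
    (fun z w hzw => by
      obtain ⟨i, x⟩ := z
      obtain ⟨j, y⟩ := w
      obtain ⟨rfl, h2⟩ := Prod.ext_iff.1 hzw
      obtain ⟨k, rfl⟩ := exists_pow_of_cycleClass_eq σ x y h2
      exact ⟨k, hσ' k _ x⟩)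
    α (fun c => by rw [hα]; positivity) hinj (fun _ => True) rep rep
    (fun c hc => absurd trivial hc) (fun _ => 0) (fun c hc => absurd trivial hc) μ v hv0 (by
      rintro ⟨i, x⟩
      have h := congrFun hv (i, σ x)
      rw [Pi.smul_apply, smul_eq_mul] at h
      rw [show σ' (i, x) = (i, σ x) from rfl, ← h]
      simp only [not_true_eq_false, false_and, if_false, Finset.sum_const_zero, add_zero,
        Matrix.mulVec, dotProduct]
      rw [Finset.sum_eq_single (i, x)]
      · simp [α, cyc]
      · rintro ⟨j, y⟩ - hne
        by_cases hij : i = j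
        · subst hij
          have hxy : x ≠ y := fun h' => hne (by rw [h'])
          simp [hxy]
        · simp [hij]
      · intro h'
        exact absurd (Finset.mem_univ _) h')
  apply hNV (rep r) (hrep r)
  have h1 := congrFun hh ()
  simp only [Matrix.mulVec, dotProduct, Matrix.map_apply, Matrix.of_apply, Pi.zero_apply] at h1
  rw [Finset.sum_eq_single (rep r)] at h1
  · simpa [hrep] using h1
  · intro z _ hz
    by_cases hvz : v z = 0
    · rw [hvz, mul_zero]
    · rw [if_neg, map_zero, zero_mul]
      intro h2
      rw [huniq z trivial hvz] at h2
      exact hz h2.symm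
  · intro h'
    exact absurd (Finset.mem_univ _) h'

/-! ### The three generic properties -/

section Generic

variable {n N : ℕ} {p : Fin N → ℕ} {A : Matrix (Fin n) (Fin n) ℝ}
  {C : ∀ i : Fin N, Matrix (Fin (p i)) (Fin n) ℝ} {W : Matrix (Fin N) (Fin N) ℝ}

theorem isGeneric_observable_kronecker_single (hW : ∀ i, W i i ≠ 0) (hA : sRank A = n) :
    ∃ h : Matrix Unit (Fin N × Fin n) ℝ, IsGeneric fun θ : NetParam W A C → ℝ =>
      Observable
        (fill W (fun e => θ (Sum.inl e)) ⊗ₖ fill A (fun e => θ (Sum.inr (Sum.inl e)))) h := by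
  obtain ⟨σ, hσ⟩ := exists_perm_of_sRank A hA
  obtain ⟨d, a, h, hobs⟩ := exists_observable_diagonal_kronecker N σ
  refine ⟨h, isGeneric_observable
    (fillPoly W (fun e => (Sum.inl e : NetParam W A C)) ⊗ₖ
      fillPoly A (fun e => (Sum.inr (Sum.inl e) : NetParam W A C)))
    (h.map MvPolynomial.C) ?_ ?_
    (Sum.elim (fun e => Matrix.diagonal d e.1.1 e.1.2)
      (Sum.elim (fun e => (Matrix.of fun y x => if y = σ x then a x else 0) e.1.1 e.1.2)
        fun _ => 0)) ?_⟩
  · intro θ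
    ext i j
    rw [Matrix.map_apply, Matrix.kroneckerMap_apply, Matrix.kroneckerMap_apply, map_mul,
      eval_fillPoly, eval_fillPoly]
  · intro θ
    ext i j
    simp
  · simp only [Sum.elim_inl, Sum.elim_inr]
    rw [fill_eq_of_support W (Matrix.diagonal d), fill_eq_of_support A
      (Matrix.of fun y x => if y = σ x then a x else 0)]
    · exact hobs
    · intro y x hyx
      by_cases h' : y = σ x
      · rw [h']
        exact hσ x
      · rw [Matrix.of_apply, if_neg h'] at hyx
        exact absurd rfl hyx
    · intro i j hij
      by_cases h' : i = j
      · rw [← h']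
        exact hW i
      · exact absurd (Matrix.diagonal_apply_ne d h') hij

open Classical in
/-- The network is generically observable from a set of agents that every agent can reach. -/
theorem isGeneric_observable_network (hW : ∀ i, W i i ≠ 0) (S : Set (Fin N))
    (hS : ∀ i, ∃ j ∈ S, HasPath W i j) :
    IsGeneric fun θ : NetParam W A C → ℝ =>
      Observable (fill W (fun e => θ (Sum.inl e)))
        (Matrix.diagonal fun i => if i ∈ S then (1 : ℝ) else 0) := by
  -- The self-loops serve as the matching: each agent is its own cycle.
  obtain ⟨B, hB, heig⟩ := exists_matrix_eigenvector_ne_zero W 1 hW S hS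
  refine isGeneric_observable (fillPoly W (fun e => (Sum.inl e : NetParam W A C)))
    ((Matrix.diagonal fun i => if i ∈ S then (1 : ℝ) else 0).map MvPolynomial.C) ?_ ?_
    (Sum.elim (fun e => B e.1.1 e.1.2) fun _ => 0) ?_
  · intro θ
    ext i j
    rw [Matrix.map_apply, eval_fillPoly]
  · intro θ
    ext i j
    rw [Matrix.map_apply, Matrix.map_apply, MvPolynomial.eval_C]
  · simp only [Sum.elim_inl]
    rw [fill_eq_of_support W B hB]
    refine observable_of_eigenvector _ _ fun μ v hv hh => ?_
    by_contra hv0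
    obtain ⟨r, hr, hvr, -⟩ := heig μ v hv hv0
    apply hvr
    have h1 := congrFun hh r
    rw [toComplex, Matrix.diagonal_map (map_zero _), Matrix.mulVec_diagonal, if_pos hr] at h1
    simpa using h1

/-- A system with full structural rank is generically observable when every parent component is
observed by one chosen agent. -/
theorem isGeneric_observable_system (hA : sRank A = n) (κ : {K // IsParentSCC A K} → Fin N)
    (hκ : ∀ K, Observes (C (κ K)) K.1) [Fintype {K // IsParentSCC A K}] :
    IsGeneric fun θ : NetParam W A C → ℝ =>
      Observable (fill A (fun e => θ (Sum.inr (Sum.inl e))))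
        (Matrix.of fun (q : Σ K : {K // IsParentSCC A K}, Fin (p (κ K))) x =>
          fill (C (κ q.1)) (fun e => θ (Sum.inr (Sum.inr ⟨κ q.1, e⟩))) q.2 x) := by
  classical
  obtain ⟨σ, hσ⟩ := exists_perm_of_sRank A hA
  choose a ha row hrow using hκ
  obtain ⟨B, hB, heig⟩ := exists_matrix_eigenvector_ne_zero A σ hσ (Set.range a) (by
    intro x
    obtain ⟨K, hK, hp⟩ := exists_parentSCC A x
    exact ⟨a ⟨K, hK⟩, ⟨_, rfl⟩, hp _ (ha ⟨K, hK⟩)⟩)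
  -- Several components may share a sensor row, which then sums their states `a K`. No cancellation
  -- occurs, as an eigenvector of `B` is nonzero at only one of them.
  let C₀ : ∀ i, Matrix (Fin (p i)) (Fin n) ℝ := fun i => Matrix.of fun q x =>
    if ∃ K, (⟨κ K, row K⟩ : Σ i, Fin (p i)) = ⟨i, q⟩ ∧ a K = x then 1 else 0
  have hC₀ : ∀ i q x, C₀ i q x ≠ 0 → C i q x ≠ 0 := by
    intro i q x h
    by_cases hK : ∃ K, (⟨κ K, row K⟩ : Σ i, Fin (p i)) = ⟨i, q⟩ ∧ a K = x
    · obtain ⟨K, hK1, rfl⟩ := hK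
      cases hK1
      exact hrow K
    · exact absurd (if_neg hK) h
  refine isGeneric_observable
    (fillPoly A (fun e => (Sum.inr (Sum.inl e) : NetParam W A C)))
    (Matrix.of fun q x => fillPoly (C (κ q.1))
      (fun e => (Sum.inr (Sum.inr ⟨κ q.1, e⟩) : NetParam W A C)) q.2 x) ?_ ?_
    (Sum.elim (fun _ => 0) (Sum.elim (fun e => B e.1.1 e.1.2)
      fun e => C₀ e.1 e.2.1.1 e.2.1.2)) ?_
  · intro θ
    ext i j
    rw [Matrix.map_apply, eval_fillPoly]
  · intro θ
    ext i j
    rw [Matrix.map_apply, Matrix.of_apply, eval_fillPoly, Matrix.of_apply]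
  · simp only [Sum.elim_inl, Sum.elim_inr]
    rw [fill_eq_of_support A B hB]
    refine observable_of_eigenvector _ _ fun μ v hv hh => ?_
    by_contra hv0
    obtain ⟨_, ⟨K, rfl⟩, hvr, huniq⟩ := heig μ v hv hv0
    apply hvr
    have h1 := congrFun hh ⟨K, row K⟩
    simp only [Matrix.mulVec, dotProduct, Matrix.map_apply, Matrix.of_apply, Pi.zero_apply] at h1
    have hfill : ∀ x, fill (C (κ K)) (fun e => C₀ (κ K) e.1.1 e.1.2) (row K) x =
        C₀ (κ K) (row K) x := fun x =>
      congrFun (congrFun (fill_eq_of_support (C (κ K)) (C₀ (κ K)) (hC₀ (κ K))) (row K)) x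
    simp only [hfill] at h1
    rw [Finset.sum_eq_single (a K)] at h1
    · have h2 : C₀ (κ K) (row K) (a K) = 1 := if_pos ⟨K, rfl, rfl⟩
      rw [h2, map_one, one_mul] at h1
      exact h1
    · intro x _ hx
      by_cases hvx : v x = 0
      · rw [hvx, mul_zero]
      · have h2 : C₀ (κ K) (row K) x = 0 := by
          refine if_neg ?_
          rintro ⟨K', -, rfl⟩
          have hmem : a K' ∈ K.1 := K.2.mem_of_hasPath (ha K)
            (hasPath_of_sameCycle hσ (huniq _ ⟨K', rfl⟩ hvx))
          have hKK : K = K' := Subtype.ext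
            ((K.2.1.eq_of_mem hmem).trans (K'.2.1.eq_of_mem (ha K')).symm)
          exact hx (by rw [hKK])
        rw [h2, map_zero, zero_mul]
    · intro h'
      exact absurd (Finset.mem_univ _) h'

end Generic

/-! ### The kernel of the outputs and the conclusion -/

open scoped ComplexOrder in
/-- The kernel of `blockdiag (C₁ᵀC₁, …, C_NᵀC_N)` is the kernel of `blockdiag (C₁, …, C_N)`. -/
theorem mulVec_eq_zero_of_outputNoFusion {n N : ℕ} {p : Fin N → ℕ}
    (C : ∀ i : Fin N, Matrix (Fin (p i)) (Fin n) ℝ) (x : Fin N × Fin n → ℂ)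
    (hx : (toComplex (outputNoFusion C)).mulVec x = 0) (i : Fin N) :
    (toComplex (C i)).mulVec (fun j => x (i, j)) = 0 := by
  have hconj : (toComplex (C i)).conjTranspose = (toComplex (C i)).transpose := by
    ext a b
    simp
  rw [← Matrix.conjTranspose_mul_self_mulVec_eq_zero, hconj]
  funext a
  refine Eq.trans ?_ (congrFun hx (i, a))
  simp only [Matrix.mulVec, dotProduct, Fintype.sum_prod_type]
  rw [Finset.sum_eq_single i]
  · refine Finset.sum_congr rfl fun b _ => ?_
    simp [outputNoFusion, Matrix.mul_apply]
  · intro k _ hk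
    refine Finset.sum_eq_zero fun b _ => ?_
    simp [outputNoFusion, hk.symm]
  · intro h'
    exact absurd (Finset.mem_univ _) h'

end NetEst

theorem mainTheorem2 (n N : ℕ) (p : Fin N → ℕ)
    (A : Matrix (Fin n) (Fin n) ℝ)
    (C : ∀ i : Fin N, Matrix (Fin (p i)) (Fin n) ℝ)
    (W : Matrix (Fin N) (Fin N) ℝ)
    (hW : ∀ i : Fin N, W i i ≠ 0)
    (hA : NetEst.sRank A = n)
    (hpath : ∀ K : Set (Fin n), NetEst.IsParentSCC A K →
      ∀ i : Fin N, ¬ NetEst.Observes (C i) K →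
        ∃ j : Fin N, NetEst.Observes (C j) K ∧ NetEst.HasPath W i j) :
    NetEst.GenericallyObservableNoFusion W A C := by
  classical
  have : Fintype {K // NetEst.IsParentSCC A K} := Fintype.ofFinite _
  obtain ⟨h, hG₁⟩ := NetEst.isGeneric_observable_kronecker_single (C := C) hW hA
  have hG₂ := NetEst.IsGeneric.forall fun K : {K // NetEst.IsParentSCC A K} =>
    NetEst.isGeneric_observable_network (A := A) (C := C) hW
      {j | NetEst.Observes (C j) K.1} (by
        intro i
        by_cases hi : NetEst.Observes (C i) K.1
        · exact ⟨i, hi, Relation.ReflTransGen.refl⟩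
        · exact hpath K.1 K.2 i hi)
  have hG₃ := NetEst.IsGeneric.forall
    fun κ : {κ : {K // NetEst.IsParentSCC A K} → Fin N // ∀ K, NetEst.Observes (C (κ K)) K.1} =>
      NetEst.isGeneric_observable_system (W := W) hA κ.1 κ.2
  refine (hG₁.and (hG₂.and hG₃)).mono ?_
  rintro θ ⟨h₁, h₂, h₃⟩
  refine NetEst.observable_of_eigenvector _ _ fun ν x hx hout => ?_
  by_contra hx0
  obtain ⟨u, v, l, μ, hu, hv, hu0, hv0, huv⟩ :=
    NetEst.eigenvector_kronecker_eq_tensor h₁ hx hx0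
  have hout' := NetEst.mulVec_eq_zero_of_outputNoFusion _ x hout
  -- Quantifying (3) over all choices `κ` lets the choice depend on `v`: were each component
  -- observed by some agent blind to `v`, those agents would form a forbidden choice.
  have hK : ∃ K : {K // NetEst.IsParentSCC A K}, ∀ j, NetEst.Observes (C j) K.1 →
      (NetEst.toComplex (NetEst.fill (C j)
        (fun e => θ (Sum.inr (Sum.inr ⟨j, e⟩))))).mulVec v ≠ 0 := by
    by_contra! hcon
    choose κ hκ hκv using hcon
    refine hv0 ((h₃ ⟨κ, hκ⟩).eigenvector_eq_zero hv ?_)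
    funext q
    exact congrFun (hκv q.1) q.2
  obtain ⟨K, hK⟩ := hK
  refine hu0 ((h₂ K).eigenvector_eq_zero hu ?_)
  funext j
  rw [NetEst.toComplex, Matrix.diagonal_map (map_zero _), Matrix.mulVec_diagonal]
  by_cases hj : NetEst.Observes (C j) K.1
  · have h4 := hout' j
    have h5 : (fun k => x (j, k)) = u j • v := by
      funext k
      exact huv j k
    rw [h5, Matrix.mulVec_smul, smul_eq_zero] at h4
    rw [h4.resolve_right (hK j hj), mul_zero]
    rfl
  · rw [if_neg (by exact hj), map_zero, zero_mul]
    rfl
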